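/- Let $B_3=\langle \sigma_1,\sigma_2 \mid \sigma_1\sigma_2\sigma_1=\sigma_2\sigma_1\sigma_2\rangle$ be the braid group on three strands and $\Delta=\sigma_1\sigma_2\sigma_1$, so that $\Delta^2$ is the full twist. Dehornoy's ordering on $B_3$ is given by $\alpha\prec\beta$ if and only if, for some $i\in\{1,2\}$, the braid $\alpha^{-1}\beta$ is represented by a braid word that contains $\sigma_i$ but neither $\sigma_i^{-1}$ nor any $\sigma_j^{\pm1}$ with $j<i$. The Dehornoy floor $[\beta]_D$ of $\beta\in B_3$ is the integer $m$ with $\Delta^{2m}\preceq\beta\prec\Delta^{2m+2}$, and the fractional Dehn twist coefficient of $\beta$ is $$BT(\beta)=\lim_{k\to\infty}\frac{[\beta^k]_D}{k}.$$ Let $d\in\mathbb Z$ and let $w\in B_3$ be in Murasugi normal form with full-twist exponent $d$, that is, in one of the following classes: (1) $w=\Delta^{2d}\sigma_1\sigma_2^{-a_1}\cdots\sigma_1\sigma_2^{-a_n}$ with $n\ge 1$ and integers $a_i\ge 0$, at least one of which is nonzero; (2) $w=\Delta^{2d}\sigma_2^m$ with $m\in\mathbb Z$; (3) $w=\Delta^{2d}\sigma_1^m\sigma_2^{-1}$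 with $m\in\{-1,-2,-3\}$. Then $BT(w)$ is well defined (every power $w^k$, $k\ge 0$, has exactly one Dehornoy floor, and the limit exists), and: - $BT(w)=d$ if $w$ is in class (1); - $BT(w)=d$ if $w$ is in class (2); - if $w$ is in class (3), then $BT(w)=d-\tfrac13$ when $m=-1$, $BT(w)=d-\tfrac12$ when $m=-2$, and $BT(w)=d-\tfrac23$ when $m=-3$. -/

import Mathlib

open Filter Topology

namespace Braid

/-- The Artin relations on the free group on `σ_1, …, σ_{n-1}`; the generator `σ_{i+1}` is indexed
by `i : Fin (n - 1)`. -/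
def artinRels (n : ℕ) : Set (FreeGroup (Fin (n - 1))) :=
  {r | ∃ i j : Fin (n - 1), (i : ℕ) + 2 ≤ (j : ℕ) ∧
      r = FreeGroup.of i * FreeGroup.of j * (FreeGroup.of j * FreeGroup.of i)⁻¹} ∪
  {r | ∃ i j : Fin (n - 1), (j : ℕ) = (i : ℕ) + 1 ∧
      r = FreeGroup.of i * FreeGroup.of j * FreeGroup.of i *
        (FreeGroup.of j * FreeGroup.of i * FreeGroup.of j)⁻¹}

/-- Artin's braid group `B_n` on `n` strands. -/
abbrev BraidGroup (n : ℕ) : Type := PresentedGroup (artinRels n)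

/-- The Artin generator with index `i`. -/
def gen {n : ℕ} (i : Fin (n - 1)) : BraidGroup n := PresentedGroup.of i

/-- The braid represented by a braid word, that is, by a list of letters `(i, true)`, standing for
`σ_{i+1}`, and `(i, false)`, standing for `σ_{i+1}⁻¹`. -/
def ofWord {n : ℕ} (L : List (Fin (n - 1) × Bool)) : BraidGroup n :=
  PresentedGroup.mk (artinRels n) (FreeGroup.mk L)

/-- The Garside braid
`Δ = (σ_1 σ_2 ⋯ σ_{n-1}) (σ_1 σ_2 ⋯ σ_{n-2}) ⋯ (σ_1 σ_2) (σ_1)` of `B_n`. -/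
def garside (n : ℕ) : BraidGroup n :=
  ((List.finRange (n - 1)).reverse.map fun k =>
    (((List.finRange (n - 1)).filter fun i => i ≤ k).map gen).prod).prod

/-- `β ≻ 1` in Dehornoy's ordering: for some `i`, the braid `β` is represented by a `σ_i`-positive
word, one which contains `σ_i`, but neither `σ_i⁻¹` nor any `σ_j` or `σ_j⁻¹` with `j < i`. -/
def DehornoyPositive {n : ℕ} (β : BraidGroup n) : Prop :=
  ∃ (i : Fin (n - 1)) (L : List (Fin (n - 1) × Bool)),
    (i, true) ∈ L ∧ (i, false) ∉ L ∧ (∀ p ∈ L, i ≤ p.1) ∧ ofWord L = β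

/-- Dehornoy's (left-invariant) strict ordering: `α ≺ β` if `α⁻¹ β ≻ 1`. -/
def DehornoyLT {n : ℕ} (α β : BraidGroup n) : Prop := DehornoyPositive (α⁻¹ * β)

/-- `m` is a Dehornoy floor of `β`: `Δ^{2m} ≼ β ≺ Δ^{2m+2}`. -/
def IsDehornoyFloor {n : ℕ} (β : BraidGroup n) (m : ℤ) : Prop :=
  (garside n ^ (2 * m) = β ∨ DehornoyLT (garside n ^ (2 * m)) β) ∧
    DehornoyLT β (garside n ^ (2 * m + 2))

/-- Dehornoy's floor `[β]_D` (an arbitrary integer should `β` have no floor). -/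
noncomputable def dehornoyFloor {n : ℕ} (β : BraidGroup n) : ℤ :=
  Classical.epsilon (IsDehornoyFloor β)

/-- The fractional Dehn twist coefficient of a braid, as the homogenization
`BT(β) = lim_{k → ∞} [β^k]_D / k` of Dehornoy's floor. -/
noncomputable def BT {n : ℕ} (β : BraidGroup n) : ℝ :=
  limUnder atTop fun k : ℕ => (dehornoyFloor (β ^ k) : ℝ) / (k : ℝ)

/-- The expression defining `BT β` is meaningful: each power of `β` has exactly one Dehornoy floor,
and the limit exists. -/
def BTWellDefined {n : ℕ} (β : BraidGroup n) : Prop :=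
  (∀ k : ℕ, ∃! m : ℤ, IsDehornoyFloor (β ^ k) m) ∧
    ∃ t : ℝ, Tendsto (fun k : ℕ => (dehornoyFloor (β ^ k) : ℝ) / (k : ℝ)) atTop (𝓝 t)

/-- The generator `σ_1` of `B_3`. -/
def s₁ : BraidGroup 3 := gen ⟨0, by decide⟩

/-- The generator `σ_2` of `B_3`. -/
def s₂ : BraidGroup 3 := gen ⟨1, by decide⟩

/-- `w = Δ^{2d} σ_1 σ_2^{-a_1} ⋯ σ_1 σ_2^{-a_n}` with all `a_i ≥ 0` and some `a_i ≠ 0`. -/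
def MurasugiClass1 (d : ℤ) (w : BraidGroup 3) : Prop :=
  ∃ a : List ℕ, (∃ x ∈ a, x ≠ 0) ∧
    w = garside 3 ^ (2 * d) * (a.map fun x => s₁ * s₂ ^ (-(x : ℤ))).prod

/-- `w = Δ^{2d} σ_2^m` with `m` an integer. -/
def MurasugiClass2 (d : ℤ) (w : BraidGroup 3) : Prop :=
  ∃ m : ℤ, w = garside 3 ^ (2 * d) * s₂ ^ m

/-- `w = Δ^{2d} σ_1^m σ_2⁻¹` with `m ∈ {-1, -2, -3}`. -/
def MurasugiClass3 (d m : ℤ) (w : BraidGroup 3) : Prop :=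
  (m = -1 ∨ m = -2 ∨ m = -3) ∧ w = garside 3 ^ (2 * d) * (s₁ ^ m * s₂⁻¹)

end Braid

namespace Braid

/-! The full twist Δ² is central and the ordering is left-invariant, so a factor Δ^{2d} shifts the
floor of the k-th power by exactly dk. It remains to treat the braid v left after removing Δ^{2d}:
floors of v^k that stay within a bounded distance of tk give the limit t (`bt_of_floor_bounded`).

In class (1) every v^k satisfies 1 ≼ v^k ≺ Δ². The upper bound holds because conjugation by Δ
exchanges σ₁ and σ₂, so it turns the inverse of a word in σ₁, σ₂⁻¹ into another such word
(`garside_conj_inv_mem`). In class (2) the σ₁ letters of Δ² outweigh any power of σ₂, so all floors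
are 0 or -1. In class (3), v is the inverse of a root of Δ², or of the square of such a root, and
its floors are periodic up to a shift (`bt_of_periodic`).

Floors are exhibited explicitly, so totality of the ordering is not needed. Their uniqueness needs
transitivity and acyclicity: 1 is not Dehornoy positive. For σ₁-positive words this follows from the
action on the universal cover of the rational projective line, where σ₂ fixes (0, 0) and σ₁ pushes
upwards; for σ₂-positive words the exponent sum is positive. -/

theorem garside_three : garside 3 = s₁ * s₂ * s₁ := by
  have h : (List.finRange (3 - 1)) = [⟨0, by decide⟩, ⟨1, by decide⟩] := rfl
  simp [garside, h, s₁, s₂]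

theorem braid_relation : s₁ * s₂ * s₁ = s₂ * s₁ * s₂ := by
  have h : PresentedGroup.mk (artinRels 3)
      (FreeGroup.of ⟨0, by decide⟩ * FreeGroup.of ⟨1, by decide⟩ * FreeGroup.of ⟨0, by decide⟩ *
        (FreeGroup.of ⟨1, by decide⟩ * FreeGroup.of ⟨0, by decide⟩ *
          FreeGroup.of ⟨1, by decide⟩)⁻¹) = 1 :=
    PresentedGroup.one_of_mem (Or.inr ⟨_, _, rfl, rfl⟩)
  rw [map_mul, map_inv, mul_inv_eq_one] at h
  simp only [map_mul] at h
  exact h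

/-! ### The full twist -/

theorem garside_mul_s₁ : garside 3 * s₁ = s₂ * garside 3 := by
  rw [garside_three]
  nth_rw 1 [braid_relation]
  simp only [mul_assoc]

theorem garside_mul_s₂ : garside 3 * s₂ = s₁ * garside 3 := by
  rw [garside_three, mul_assoc s₁ s₂ s₁, mul_assoc s₁, ← braid_relation, mul_assoc s₁ s₂ s₁]

/-- The full twist `Δ²` of `B_3`. -/
def fullTwist : BraidGroup 3 := garside 3 * garside 3

theorem garside_zpow_two_mul (m : ℤ) : garside 3 ^ (2 * m) = fullTwist ^ m := by
  rw [zpow_mul, fullTwist, zpow_two]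

/-- Conjugation by Δ exchanges the two generators, so conjugation by Δ² fixes both. -/
theorem fullTwist_commute (β : BraidGroup 3) : Commute fullTwist β := by
  have h₁ : Commute fullTwist s₁ := by
    rw [fullTwist, commute_iff_eq, mul_assoc, garside_mul_s₁, ← mul_assoc, garside_mul_s₂, mul_assoc]
  have h₂ : Commute fullTwist s₂ := by
    rw [fullTwist, commute_iff_eq, mul_assoc, garside_mul_s₂, ← mul_assoc, garside_mul_s₁, mul_assoc]
  have h : β ∈ Subgroup.closure (Set.range (PresentedGroup.of (rels := artinRels 3))) := by
    rw [PresentedGroup.closure_range_of]; trivial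
  induction h using Subgroup.closure_induction with
  | mem x hx =>
    obtain ⟨i, rfl⟩ := hx
    obtain ⟨i, hi⟩ := i
    have : i = 0 ∨ i = 1 := by omega
    rcases this with rfl | rfl
    · exact h₁
    · exact h₂
  | one => exact Commute.one_right _
  | mul x y _ _ hx hy => exact hx.mul_right hy
  | inv x _ hx => exact hx.inv_right

/-! ### Positive braids -/

theorem ofWord_nil {n : ℕ} : ofWord ([] : List (Fin (n - 1) × Bool)) = 1 :=
  map_one (PresentedGroup.mk (artinRels n))

theorem ofWord_append {n : ℕ} (L L' : List (Fin (n - 1) × Bool)) :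
    ofWord (L ++ L') = ofWord L * ofWord L' := by
  simp only [ofWord, ← map_mul, FreeGroup.mul_mk]

theorem ofWord_singleton_true {n : ℕ} (i : Fin (n - 1)) : ofWord [(i, true)] = gen i := rfl

theorem ofWord_singleton_false {n : ℕ} (i : Fin (n - 1)) : ofWord [(i, false)] = (gen i)⁻¹ := by
  rw [gen, PresentedGroup.of, ← map_inv, FreeGroup.of, FreeGroup.inv_mk]; rfl

/-- Words are concatenated; the smaller of the two indices witnesses positivity. This is
transitivity of the ordering. -/
theorem DehornoyPositive.mul {n : ℕ} {α β : BraidGroup n} (hα : DehornoyPositive α)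
    (hβ : DehornoyPositive β) : DehornoyPositive (α * β) := by
  obtain ⟨i, L, h₁, h₂, h₃, rfl⟩ := hα
  obtain ⟨j, L', k₁, k₂, k₃, rfl⟩ := hβ
  rcases lt_trichotomy i j with h | rfl | h
  · refine ⟨i, L ++ L', by simp [h₁], ?_, ?_, ofWord_append _ _⟩
    · simp only [List.mem_append, not_or]
      exact ⟨h₂, fun hm => absurd (k₃ _ hm) (not_le.2 h)⟩
    · simp only [List.mem_append]
      rintro p (hp | hp)
      exacts [h₃ p hp, h.le.trans (k₃ p hp)]
  · refine ⟨i, L ++ L', by simp [h₁], by simp [h₂, k₂], ?_, ofWord_append _ _⟩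
    simp only [List.mem_append]
    rintro p (hp | hp)
    exacts [h₃ p hp, k₃ p hp]
  · refine ⟨j, L ++ L', by simp [k₁], ?_, ?_, ofWord_append _ _⟩
    · simp only [List.mem_append, not_or]
      exact ⟨fun hm => absurd (h₃ _ hm) (not_le.2 h), k₂⟩
    · simp only [List.mem_append]
      rintro p (hp | hp)
      exacts [h.le.trans (h₃ p hp), k₃ p hp]

/-- The braids of `B_3` represented by a word without `σ_1⁻¹`. -/
def sigmaOneNonneg : Submonoid (BraidGroup 3) where
  carrier := {β | ∃ L : List (Fin (3 - 1) × Bool),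
    (((⟨0, by decide⟩ : Fin (3 - 1)), false) ∉ L) ∧ ofWord L = β}
  one_mem' := ⟨[], by simp, ofWord_nil⟩
  mul_mem' := by
    rintro _ _ ⟨L, h, rfl⟩ ⟨L', h', rfl⟩
    exact ⟨L ++ L', fun hm => (List.mem_append.1 hm).elim h h', ofWord_append _ _⟩

theorem s₁_mem : s₁ ∈ sigmaOneNonneg := ⟨[(⟨0, by decide⟩, true)], by simp, rfl⟩

theorem s₂_mem : s₂ ∈ sigmaOneNonneg := ⟨[(⟨1, by decide⟩, true)], by simp, rfl⟩

theorem s₂_inv_mem : s₂⁻¹ ∈ sigmaOneNonneg :=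
  ⟨[(⟨1, by decide⟩, false)], by simp, ofWord_singleton_false _⟩

theorem s₂_zpow_mem (m : ℤ) : s₂ ^ m ∈ sigmaOneNonneg := by
  cases m with
  | ofNat k => rw [Int.ofNat_eq_natCast, zpow_natCast]; exact pow_mem s₂_mem k
  | negSucc k => rw [zpow_negSucc, ← inv_pow]; exact pow_mem s₂_inv_mem _

theorem dehornoyPositive_mul_s₁_mul {x y : BraidGroup 3} (hx : x ∈ sigmaOneNonneg)
    (hy : y ∈ sigmaOneNonneg) : DehornoyPositive (x * s₁ * y) := by
  obtain ⟨L, h, rfl⟩ := hx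
  obtain ⟨L', h', rfl⟩ := hy
  refine ⟨⟨0, by decide⟩, L ++ [(⟨0, by decide⟩, true)] ++ L', by simp, ?_,
    fun p _ => Nat.zero_le _, ?_⟩
  · simp only [List.mem_append, not_or]
    exact ⟨⟨h, by simp⟩, h'⟩
  · rw [ofWord_append, ofWord_append]; rfl

theorem dehornoyPositive_s₂_pow (k : ℕ) (hk : k ≠ 0) : DehornoyPositive (s₂ ^ k) := by
  refine ⟨⟨1, by decide⟩, List.replicate k (⟨1, by decide⟩, true), by simp [hk], ?_, ?_, ?_⟩
  · simp [List.mem_replicate]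
  · intro p hp
    rw [List.eq_of_mem_replicate hp]
  · clear hk
    induction k with
    | zero => exact ofWord_nil
    | succ k ih =>
      rw [pow_succ, List.replicate_succ', ofWord_append, ih]; rfl

theorem garside_mem : garside 3 ∈ sigmaOneNonneg := by
  rw [garside_three]; exact mul_mem (mul_mem s₁_mem s₂_mem) s₁_mem

theorem dehornoyPositive_garside_mul {y : BraidGroup 3} (hy : y ∈ sigmaOneNonneg) :
    DehornoyPositive (garside 3 * y) := by
  have := dehornoyPositive_mul_s₁_mul (one_mem _) (mul_mem (mul_mem s₂_mem s₁_mem) hy)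
  rw [garside_three]
  simpa only [one_mul, mul_assoc] using this

theorem dehornoyPositive_fullTwist_mul {y : BraidGroup 3} (hy : y ∈ sigmaOneNonneg) :
    DehornoyPositive (fullTwist * y) := by
  rw [fullTwist, mul_assoc]
  exact dehornoyPositive_garside_mul (mul_mem garside_mem hy)

theorem dehornoyPositive_fullTwist : DehornoyPositive fullTwist := by
  simpa using dehornoyPositive_fullTwist_mul (one_mem _)

/-! ### Acyclicity

`B_3` acts on the universal cover `ℤ × (ℚ ∪ {∞})` of the rational projective line. -/

/-- The lift of `q ↦ q + 1`. -/
def translation : Equiv.Perm (ℤ × Option ℚ) where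
  toFun x := (x.1, x.2.map (· + 1))
  invFun x := (x.1, x.2.map (· - 1))
  left_inv := by rintro ⟨n, _ | q⟩ <;> simp
  right_inv := by rintro ⟨n, _ | q⟩ <;> simp

/-- The lift of `q ↦ q / (1 - q)`, as a function. -/
def shearFun : ℤ × Option ℚ → ℤ × Option ℚ
  | (n, none) => (n + 1, some (-1))
  | (n, some q) =>
    if q < 1 then (n, some (q / (1 - q))) else if q = 1 then (n, none) else
      (n + 1, some (q / (1 - q)))

/-- The lift of `q ↦ q / (1 + q)`, as a function. -/
def shearInv : ℤ × Option ℚ → ℤ × Option ℚ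
  | (n, none) => (n, some 1)
  | (n, some q) =>
    if -1 < q then (n, some (q / (1 + q))) else if q = -1 then (n - 1, none) else
      (n - 1, some (q / (1 + q)))

theorem shearFun_of_lt (n : ℤ) {q : ℚ} (h : q < 1) :
    shearFun (n, some q) = (n, some (q / (1 - q))) := by
  simp [shearFun, h]

theorem shearFun_of_gt (n : ℤ) {q : ℚ} (h : 1 < q) :
    shearFun (n, some q) = (n + 1, some (q / (1 - q))) := by
  simp [shearFun, h.not_gt, h.ne']

theorem shearFun_one (n : ℤ) : shearFun (n, some 1) = (n, none) := by simp [shearFun]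

theorem shearFun_none (n : ℤ) : shearFun (n, none) = (n + 1, some (-1)) := rfl

theorem shearInv_of_gt (n : ℤ) {q : ℚ} (h : -1 < q) :
    shearInv (n, some q) = (n, some (q / (1 + q))) := by
  simp [shearInv, h]

theorem shearInv_of_lt (n : ℤ) {q : ℚ} (h : q < -1) :
    shearInv (n, some q) = (n - 1, some (q / (1 + q))) := by
  simp [shearInv, h.not_gt, h.ne]

theorem shearInv_neg_one (n : ℤ) : shearInv (n, some (-1)) = (n - 1, none) := by simp [shearInv]

theorem shearInv_none (n : ℤ) : shearInv (n, none) = (n, some 1) := rfl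

/-- The lift of `q ↦ q / (1 - q)`. -/
def shear : Equiv.Perm (ℤ × Option ℚ) where
  toFun := shearFun
  invFun := shearInv
  left_inv := by
    rintro ⟨n, _ | q⟩
    · simp [shearFun_none, shearInv_neg_one]
    · rcases lt_trichotomy q 1 with h | rfl | h
      · have h' : 0 < 1 - q := by linarith
        rw [shearFun_of_lt n h, shearInv_of_gt]
        · congr 2; field_simp; ring
        · rw [lt_div_iff₀ h']; linarith
      · simp [shearFun_one, shearInv_none]
      · have h' : 1 - q < 0 := by linarith
        rw [shearFun_of_gt n h, shearInv_of_lt]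
        · have := h'.ne
          rw [add_sub_cancel_right]; congr 2; field_simp; ring
        · rw [div_lt_iff_of_neg h']; linarith
  right_inv := by
    rintro ⟨n, _ | q⟩
    · simp [shearFun_one, shearInv_none]
    · rcases lt_trichotomy q (-1) with h | rfl | h
      · have h' : 1 + q < 0 := by linarith
        rw [shearInv_of_lt n h, shearFun_of_gt]
        · have := h'.ne
          rw [sub_add_cancel]; congr 2; field_simp; ring
        · rw [lt_div_iff_of_neg h']; linarith
      · simp [shearFun_none, shearInv_neg_one]
      · have h' : 0 < 1 + q := by linarith
        rw [shearInv_of_gt n h, shearFun_of_lt]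
        · congr 2; field_simp; ring
        · rw [div_lt_iff₀ h']; linarith

theorem shear_apply (x : ℤ × Option ℚ) : shear x = shearFun x := rfl

theorem shear_symm_apply (x : ℤ × Option ℚ) : shear.symm x = shearInv x := rfl

/-- Below the cover, both sides are q ↦ -1/q. The case splits at 0 and 1 record when a shear passes
∞ and raises the level; both sides do so the same number of times. -/
theorem translation_shear_braid :
    translation * shear * translation = shear * translation * shear := by
  ext1 ⟨n, x⟩
  change translation (shearFun (translation (n, x))) =
    shearFun (translation (shearFun (n, x)))
  have ht (n : ℤ) (q : ℚ) : translation (n, some q) = (n, some (q + 1)) := rfl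
  have ht' (n : ℤ) : translation (n, none) = (n, none) := rfl
  rcases x with _ | q
  · rw [ht', shearFun_none, ht, shearFun_of_lt (q := -1 + 1) _ (by norm_num)]
    norm_num
  · rw [ht]
    rcases lt_trichotomy q 0 with h | rfl | h
    · have h' : 0 < 1 - q := by linarith
      have := h.ne
      rw [shearFun_of_lt n (q := q + 1) (by linarith), shearFun_of_lt n (q := q) (by linarith), ht,
        ht, shearFun_of_lt]
      · congr 2
        have e : q / (1 - q) + 1 = 1 / (1 - q) := by field_simp; ring
        have e' : 1 - 1 / (1 - q) = -q / (1 - q) := by field_simp; ring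
        rw [e, e', show 1 - (q + 1) = -q by ring]
        field_simp; ring
      · rw [← sub_pos]
        have e : 1 - (q / (1 - q) + 1) = -q / (1 - q) := by field_simp; ring
        rw [e]; exact div_pos (by linarith) h'
    · norm_num [shearFun_one, shearFun_of_lt, ht, ht']
    · rw [shearFun_of_gt n (q := q + 1) (by linarith), ht]
      have := h.ne'
      rcases lt_trichotomy q 1 with h1 | rfl | h1
      · have h' : 0 < 1 - q := by linarith
        have e : q / (1 - q) + 1 = 1 / (1 - q) := by field_simp; ring
        rw [shearFun_of_lt n h1, ht, e, shearFun_of_gt]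
        · congr 2
          have e' : 1 - 1 / (1 - q) = -q / (1 - q) := by field_simp; ring
          rw [e', show 1 - (q + 1) = -q by ring]
          field_simp; ring
        · rw [lt_div_iff₀ h']; linarith
      · norm_num [shearFun_one, shearFun_none, ht']
      · have h' : 1 - q < 0 := by linarith
        have h'' := h'.ne
        have e : q / (1 - q) + 1 = 1 / (1 - q) := by field_simp; ring
        rw [shearFun_of_gt n h1, ht, e, shearFun_of_lt]
        · congr 2
          have e' : 1 - 1 / (1 - q) = -q / (1 - q) := by field_simp; ring
          rw [e', show 1 - (q + 1) = -q by ring]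
          field_simp; ring
        · rw [div_lt_iff_of_neg h']; linarith

/-- The action of `B_3` on the universal cover of the rational projective line. -/
def coverAction : BraidGroup 3 →* Equiv.Perm (ℤ × Option ℚ) :=
  PresentedGroup.toGroup (f := fun i : Fin (3 - 1) => if (i : ℕ) = 0 then translation else shear) <| by
    rintro r (⟨⟨i, hi⟩, ⟨j, hj⟩, h, -⟩ | ⟨⟨i, hi⟩, ⟨j, hj⟩, h, rfl⟩)
    · simp only at h; omega
    · simp only at h
      obtain rfl : i = 0 := by omega
      obtain rfl : j = 1 := by omega
      rw [map_mul, map_inv, mul_inv_eq_one]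
      simpa using translation_shear_braid

theorem coverAction_s₁ : coverAction s₁ = translation := by
  simp [coverAction, s₁, gen]

theorem coverAction_s₂ : coverAction s₂ = shear := by
  simp [coverAction, s₂, gen]

/-- The points of the cover at or above `(0, 0)`. -/
def upperRay : Set (ℤ × Option ℚ) :=
  {x | 0 < x.1 ∨ x.1 = 0 ∧ ∀ q ∈ x.2, 0 ≤ q}

/-- Each level n is ordered as ℚ with `none` (the point ∞) on top, and level n + 1 follows.
Translation fixes ∞ and moves every rational point strictly up, so nothing in the ray lands on its
least point. -/
theorem translation_mem_upperRay {x : ℤ × Option ℚ} (hx : x ∈ upperRay) :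
    translation x ∈ upperRay ∧ translation x ≠ (0, some 0) := by
  obtain ⟨n, _ | q⟩ := x
  · exact ⟨hx, by simp [translation]⟩
  · have h : translation (n, some q) = (n, some (q + 1)) := rfl
    rw [h]
    simp only [upperRay, Set.mem_ofPred_eq, Option.mem_some_iff, forall_eq', ne_eq, Prod.mk.injEq,
      Option.some.injEq] at hx ⊢
    rcases hx with hx | ⟨rfl, hx⟩
    · exact ⟨Or.inl hx, fun h => by omega⟩
    · exact ⟨Or.inr ⟨rfl, by linarith⟩, fun h => by linarith [h.2]⟩

theorem shear_mem_upperRay {x : ℤ × Option ℚ} (hx : x ∈ upperRay) : shear x ∈ upperRay := by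
  obtain ⟨n, _ | q⟩ := x
  · rw [shear_apply]
    simp only [upperRay, Set.mem_ofPred_eq, shearFun_none] at hx ⊢
    left; omega
  · rw [shear_apply]
    simp only [upperRay, Set.mem_ofPred_eq, Option.mem_some_iff, forall_eq'] at hx
    rcases lt_trichotomy q 1 with h | rfl | h
    · rw [shearFun_of_lt n h]
      refine hx.imp id fun hx => ⟨hx.1, ?_⟩
      simp only [Option.mem_some_iff, forall_eq']
      exact div_nonneg hx.2 (by linarith)
    · rw [shearFun_one]
      exact hx.imp id fun hx => ⟨hx.1, by simp⟩
    · rw [shearFun_of_gt n h]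
      left; simp only; omega

theorem shear_symm_mem_upperRay {x : ℤ × Option ℚ} (hx : x ∈ upperRay) :
    shear.symm x ∈ upperRay := by
  obtain ⟨n, _ | q⟩ := x
  · rw [shear_symm_apply]
    rw [shearInv_none]
    exact hx.imp id fun hx => ⟨hx.1, by simp⟩
  · rw [shear_symm_apply]
    simp only [upperRay, Set.mem_ofPred_eq, Option.mem_some_iff, forall_eq'] at hx
    rcases lt_trichotomy q (-1) with h | rfl | h
    · rw [shearInv_of_lt n h]
      rcases hx with hx | hx
      · have : 0 ≤ n - 1 := by omega
        refine this.lt_or_eq.imp id fun h0 => ⟨h0.symm, ?_⟩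
        simp only [Option.mem_some_iff, forall_eq']
        exact div_nonneg_of_nonpos (by linarith) (by linarith)
      · linarith [hx.2]
    · rw [shearInv_neg_one]
      rcases hx with hx | hx
      · have : 0 ≤ n - 1 := by omega
        exact this.lt_or_eq.imp id fun h0 => ⟨h0.symm, by simp⟩
      · linarith [hx.2]
    · rw [shearInv_of_gt n h]
      refine hx.imp id fun hx => ⟨hx.1, ?_⟩
      simp only [Option.mem_some_iff, forall_eq']
      exact div_nonneg hx.2 (by linarith)

theorem shear_origin : shear (0, some 0) = (0, some 0) := by
  rw [shear_apply]
  norm_num [shearFun_of_lt]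

/-- σ₁ and σ₂^{±1} all preserve the ray. Once a σ₁ has moved a point off the origin it cannot
return: σ₂^{±1} fix the origin, hence preserve its complement, and a further σ₁ never reaches it. -/
theorem coverAction_ofWord_mem (L : List (Fin (3 - 1) × Bool))
    (hL : ((⟨0, by decide⟩, false) : Fin (3 - 1) × Bool) ∉ L) {x : ℤ × Option ℚ}
    (hx : x ∈ upperRay) :
    coverAction (ofWord L) x ∈ upperRay ∧
      (((⟨0, by decide⟩, true) : Fin (3 - 1) × Bool) ∈ L →
        coverAction (ofWord L) x ≠ (0, some 0)) := by
  induction L with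
  | nil => rw [ofWord_nil, map_one]; exact ⟨hx, by simp⟩
  | cons p L ih =>
    obtain ⟨ih₁, ih₂⟩ := ih fun h => hL (List.mem_cons_of_mem _ h)
    rw [← List.singleton_append, ofWord_append, map_mul, Equiv.Perm.mul_apply]
    obtain ⟨⟨i, hi⟩, b⟩ := p
    have : i = 0 ∨ i = 1 := by omega
    rcases this with rfl | rfl
    · cases b
      · simp at hL
      · change coverAction s₁ _ ∈ _ ∧ (_ → coverAction s₁ _ ≠ _)
        rw [coverAction_s₁]
        exact ⟨(translation_mem_upperRay ih₁).1, fun _ => (translation_mem_upperRay ih₁).2⟩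
    · cases b
      · rw [ofWord_singleton_false]
        change coverAction s₂⁻¹ _ ∈ _ ∧ (_ → coverAction s₂⁻¹ _ ≠ _)
        rw [map_inv, coverAction_s₂]
        refine ⟨shear_symm_mem_upperRay ih₁, fun h => ?_⟩
        rw [ne_eq, Equiv.Perm.inv_eq_iff_eq, shear_origin]
        exact ih₂ (by simpa using h)
      · change coverAction s₂ _ ∈ _ ∧ (_ → coverAction s₂ _ ≠ _)
        rw [coverAction_s₂]
        refine ⟨shear_mem_upperRay ih₁, fun h => ?_⟩
        rw [ne_eq, ← shear_origin, shear.apply_eq_iff_eq]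
        exact ih₂ (by simpa using h)

/-- The exponent sum of a braid. -/
def exponentSum : BraidGroup 3 →* Multiplicative ℤ :=
  PresentedGroup.toGroup (f := fun _ : Fin (3 - 1) => Multiplicative.ofAdd 1) <| by
    rintro r (⟨i, j, -, rfl⟩ | ⟨i, j, -, rfl⟩) <;> simp

theorem exponentSum_ofWord_pos (L : List (Fin (3 - 1) × Bool)) (hL : ∀ p ∈ L, p.2 = true) :
    exponentSum (ofWord L) = Multiplicative.ofAdd (L.length : ℤ) := by
  induction L with
  | nil => rw [ofWord_nil, map_one]; rfl
  | cons p L ih =>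
    rw [← List.singleton_append, ofWord_append, map_mul,
      ih fun q hq => hL q (List.mem_cons_of_mem _ hq)]
    obtain ⟨i, b⟩ := p
    obtain rfl : b = true := hL _ List.mem_cons_self
    have : exponentSum (ofWord [(i, true)]) = Multiplicative.ofAdd 1 := by
      rw [ofWord_singleton_true]; simp [exponentSum, gen]
    rw [this, ← ofAdd_add]
    simp [add_comm]

theorem not_dehornoyPositive_one : ¬ DehornoyPositive (1 : BraidGroup 3) := by
  rintro ⟨⟨i, hi⟩, L, h₁, h₂, h₃, h⟩
  have : i = 0 ∨ i = 1 := by omega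
  rcases this with rfl | rfl
  · refine (coverAction_ofWord_mem L h₂ (x := (0, some 0)) (Or.inr ⟨rfl, by simp⟩)).2 h₁ ?_
    rw [h, map_one]; rfl
  -- A σ₂-positive word in B₃ uses only the letter σ₂, so its exponent sum is its positive length.
  · have h' := exponentSum_ofWord_pos L ?_
    · rw [h, map_one, ← ofAdd_zero, Multiplicative.ofAdd.apply_eq_iff_eq] at h'
      have := List.length_pos_of_mem h₁
      omega
    · rintro ⟨⟨j, hj⟩, b⟩ hp
      have hle : 1 ≤ j := h₃ _ hp
      obtain rfl : j = 1 := by omega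
      cases b
      · exact absurd hp h₂
      · rfl

/-! ### The Dehornoy floor -/

theorem isDehornoyFloor_iff (β : BraidGroup 3) (m : ℤ) :
    IsDehornoyFloor β m ↔ (fullTwist ^ m = β ∨ DehornoyPositive ((fullTwist ^ m)⁻¹ * β)) ∧
      DehornoyPositive (β⁻¹ * fullTwist ^ (m + 1)) := by
  rw [IsDehornoyFloor, DehornoyLT, DehornoyLT, show 2 * m + 2 = 2 * (m + 1) by ring,
    garside_zpow_two_mul, garside_zpow_two_mul]

theorem dehornoyPositive_fullTwist_pow_succ (k : ℕ) :
    DehornoyPositive (fullTwist ^ (k + 1)) := by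
  induction k with
  | zero => simpa using dehornoyPositive_fullTwist
  | succ k ih => rw [pow_succ]; exact ih.mul dehornoyPositive_fullTwist

/-- If m < m', then β ≺ Δ^{2m+2} ≼ Δ^{2m'} ≼ β, against acyclicity. -/
theorem IsDehornoyFloor.le {β : BraidGroup 3} {m m' : ℤ} (h : IsDehornoyFloor β m)
    (h' : IsDehornoyFloor β m') : m' ≤ m := by
  rw [isDehornoyFloor_iff] at h h'
  by_contra! hlt
  have key : DehornoyPositive (β⁻¹ * fullTwist ^ m') := by
    rcases (Int.add_one_le_iff.2 hlt).eq_or_lt with rfl | hlt'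
    · exact h.2
    · obtain ⟨k, hk⟩ := Int.le.dest (Int.add_one_le_iff.2 hlt')
      have := h.2.mul (dehornoyPositive_fullTwist_pow_succ k)
      rwa [mul_assoc, ← zpow_natCast, ← zpow_add,
        show m + 1 + ((k + 1 : ℕ) : ℤ) = m' by push_cast; omega] at this
  rcases h'.1 with h0 | h0
  · rw [h0, inv_mul_cancel] at key
    exact not_dehornoyPositive_one key
  · exact not_dehornoyPositive_one (by simpa [mul_assoc] using key.mul h0)

theorem IsDehornoyFloor.unique {β : BraidGroup 3} {m m' : ℤ} (h : IsDehornoyFloor β m)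
    (h' : IsDehornoyFloor β m') : m' = m :=
  le_antisymm (h.le h') (h'.le h)

theorem IsDehornoyFloor.fullTwist_zpow_mul {v : BraidGroup 3} {m : ℤ} (h : IsDehornoyFloor v m)
    (e : ℤ) : IsDehornoyFloor (fullTwist ^ e * v) (e + m) := by
  rw [isDehornoyFloor_iff] at h ⊢
  have h₁ : (fullTwist ^ (e + m))⁻¹ * (fullTwist ^ e * v) = (fullTwist ^ m)⁻¹ * v := by
    rw [zpow_add]; group
  have h₂ : (fullTwist ^ e * v)⁻¹ * fullTwist ^ (e + m + 1) = v⁻¹ * fullTwist ^ (m + 1) := by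
    rw [add_assoc, zpow_add _ e]; group
  rw [h₁, h₂, zpow_add]
  exact ⟨h.1.imp (fun h => by rw [h]) id, h.2⟩

theorem isDehornoyFloor_zero {v : BraidGroup 3} (h : v = 1 ∨ DehornoyPositive v)
    (h' : DehornoyPositive (v⁻¹ * fullTwist)) : IsDehornoyFloor v 0 := by
  rw [isDehornoyFloor_iff]
  simpa [eq_comm] using ⟨h, h'⟩

theorem isDehornoyFloor_one : IsDehornoyFloor (1 : BraidGroup 3) 0 :=
  isDehornoyFloor_zero (Or.inl rfl) (by simpa using dehornoyPositive_fullTwist)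

theorem isDehornoyFloor_neg_one {v : BraidGroup 3} (h : DehornoyPositive (fullTwist * v))
    (h' : DehornoyPositive v⁻¹) : IsDehornoyFloor v (-1) := by
  rw [isDehornoyFloor_iff]
  simpa using ⟨Or.inr h, h'⟩

/-! ### Passing from floors to their limit -/

theorem bt_of_floor_bounded {β : BraidGroup 3} {t C : ℝ}
    (h : ∀ k : ℕ, ∃ m : ℤ, IsDehornoyFloor (β ^ k) m ∧ |(m : ℝ) - t * k| ≤ C) :
    BTWellDefined β ∧ BT β = t := by
  have hfloor (k : ℕ) : |(dehornoyFloor (β ^ k) : ℝ) - t * k| ≤ C := by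
    obtain ⟨m, hm, hC⟩ := h k
    -- Uniqueness identifies the value chosen by `Classical.epsilon` with the given floor.
    rwa [dehornoyFloor, hm.unique (Classical.epsilon_spec ⟨m, hm⟩)]
  have hlim : Tendsto (fun k : ℕ => (dehornoyFloor (β ^ k) : ℝ) / (k : ℝ)) atTop (𝓝 t) := by
    rw [tendsto_iff_dist_tendsto_zero]
    refine squeeze_zero' (Eventually.of_forall fun _ => dist_nonneg) ?_
      (tendsto_const_div_atTop_nhds_zero_nat C)
    filter_upwards [eventually_gt_atTop 0] with k hk
    have hk' : (0 : ℝ) < k := Nat.cast_pos.2 hk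
    rw [Real.dist_eq, show (dehornoyFloor (β ^ k) : ℝ) / k - t =
      ((dehornoyFloor (β ^ k) : ℝ) - t * k) / k by field_simp, abs_div, abs_of_pos hk']
    exact div_le_div_of_nonneg_right (hfloor k) hk'.le
  refine ⟨⟨fun k => ?_, t, hlim⟩, hlim.limUnder_eq⟩
  obtain ⟨m, hm, -⟩ := h k
  exact ⟨m, hm, fun m' hm' => hm.unique hm'⟩

theorem fullTwist_zpow_mul_pow (d : ℤ) (v : BraidGroup 3) (k : ℕ) :
    (fullTwist ^ d * v) ^ k = fullTwist ^ (d * k) * v ^ k := by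
  rw [((fullTwist_commute v).zpow_left d).mul_pow, zpow_mul, zpow_natCast]

theorem bt_fullTwist_zpow_mul {v : BraidGroup 3} (d : ℤ) {t C : ℝ}
    (h : ∀ k : ℕ, ∃ m : ℤ, IsDehornoyFloor (v ^ k) m ∧ |(m : ℝ) - t * k| ≤ C) :
    BTWellDefined (fullTwist ^ d * v) ∧ BT (fullTwist ^ d * v) = d + t := by
  refine bt_of_floor_bounded (C := C) fun k => ?_
  obtain ⟨m, hm, hC⟩ := h k
  refine ⟨d * k + m, ?_, ?_⟩
  · rw [fullTwist_zpow_mul_pow]; exact hm.fullTwist_zpow_mul _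
  · push_cast
    rwa [show (d * k + m - (d + t) * k : ℝ) = m - t * k by ring]

/-- A braid with a power equal to a power of the full twist. -/
theorem bt_of_periodic {v : BraidGroup 3} (d : ℤ) {p : ℕ} (hp : 0 < p) {c : ℤ}
    (hv : v ^ p = fullTwist ^ c) (h : ∀ r < p, ∃ m : ℤ, IsDehornoyFloor (v ^ r) m) :
    BTWellDefined (fullTwist ^ d * v) ∧ BT (fullTwist ^ d * v) = d + c / p := by
  have h' (r : ℕ) : ∃ m : ℤ, r < p → IsDehornoyFloor (v ^ r) m := by
    by_cases hr : r < p
    · exact (h r hr).imp fun m hm _ => hm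
    · exact ⟨0, fun h => absurd h hr⟩
  choose m hm using h'
  -- For k = pq + r with r < p, the floor of v^k is cq + m r, so the error depends on r alone; the
  -- sum over all r bounds each term.
  refine bt_fullTwist_zpow_mul d
    (C := ∑ r ∈ Finset.range p, |(m r : ℝ) - (c / p : ℝ) * r|) fun k => ?_
  have hr : k % p < p := Nat.mod_lt _ hp
  refine ⟨c * (k / p : ℕ) + m (k % p), ?_, ?_⟩
  · conv_lhs => rw [← Nat.div_add_mod k p]
    rw [pow_add, pow_mul, hv, ← zpow_natCast (fullTwist ^ c), ← zpow_mul]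
    exact (hm _ hr).fullTwist_zpow_mul _
  · have hk : (k : ℝ) = p * (k / p : ℕ) + (k % p : ℕ) := by
      exact_mod_cast (Nat.div_add_mod k p).symm
    have hp' : (p : ℝ) ≠ 0 := by positivity
    have e : ((c * (k / p : ℕ) + m (k % p) : ℤ) : ℝ) - (c / p : ℝ) * k =
        m (k % p) - (c / p : ℝ) * (k % p : ℕ) := by
      conv_lhs => rw [hk]
      rw [Int.cast_add, Int.cast_mul, Int.cast_natCast]
      field_simp
      ring
    rw [e]
    exact Finset.single_le_sum (f := fun r : ℕ => |(m r : ℝ) - (c / p : ℝ) * r|)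
      (fun _ _ => abs_nonneg _) (Finset.mem_range.2 hr)

/-! ### The three classes -/

/-- The monoid generated by `σ_1` and `σ_2⁻¹`. -/
def alternatingMonoid : Submonoid (BraidGroup 3) := Submonoid.closure {s₁, s₂⁻¹}

theorem alternatingMonoid_le : alternatingMonoid ≤ sigmaOneNonneg := by
  rw [alternatingMonoid, Submonoid.closure_le]
  rintro x (rfl | rfl)
  exacts [s₁_mem, s₂_inv_mem]

theorem garside_conj_inv_mem {x : BraidGroup 3} (hx : x ∈ alternatingMonoid) :
    garside 3 * x⁻¹ * (garside 3)⁻¹ ∈ sigmaOneNonneg := by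
  induction hx using Submonoid.closure_induction with
  | mem x hx =>
    rcases hx with rfl | rfl
    · rw [show garside 3 * s₁⁻¹ * (garside 3)⁻¹ = (garside 3 * s₁ * (garside 3)⁻¹)⁻¹ by group,
        garside_mul_s₁, mul_inv_cancel_right]
      exact s₂_inv_mem
    · rw [inv_inv, garside_mul_s₂, mul_inv_cancel_right]
      exact s₁_mem
  | one => simp [one_mem]
  | mul x y _ _ hx hy =>
    rw [show garside 3 * (x * y)⁻¹ * (garside 3)⁻¹ =
      (garside 3 * y⁻¹ * (garside 3)⁻¹) * (garside 3 * x⁻¹ * (garside 3)⁻¹) by group]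
    exact mul_mem hy hx

/-- By centrality x⁻¹Δ² = Δ · (Δx⁻¹Δ⁻¹) · Δ, in which no factor needs σ₁⁻¹ and Δ supplies a σ₁. -/
theorem dehornoyPositive_inv_mul_fullTwist {x : BraidGroup 3} (hx : x ∈ alternatingMonoid) :
    DehornoyPositive (x⁻¹ * fullTwist) := by
  rw [← (fullTwist_commute x⁻¹).eq, fullTwist,
    show garside 3 * garside 3 * x⁻¹ =
      garside 3 * (garside 3 * x⁻¹ * (garside 3)⁻¹ * garside 3) by group]
  exact dehornoyPositive_garside_mul (mul_mem (garside_conj_inv_mem hx) garside_mem)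

theorem s₁_mul_s₂_zpow_mem (x : ℕ) : s₁ * s₂ ^ (-(x : ℤ)) ∈ alternatingMonoid := by
  refine mul_mem (Submonoid.subset_closure (by simp)) ?_
  rw [zpow_neg, zpow_natCast, ← inv_pow]
  exact pow_mem (Submonoid.subset_closure (by simp)) _

theorem prod_mem_alternatingMonoid (a : List ℕ) :
    (a.map fun x : ℕ => s₁ * s₂ ^ (-(x : ℤ))).prod ∈ alternatingMonoid := by
  refine Submonoid.list_prod_mem _ fun y hy => ?_
  obtain ⟨x, -, rfl⟩ := List.mem_map.1 hy
  exact s₁_mul_s₂_zpow_mem x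

theorem bt_class1 {d : ℤ} {w : BraidGroup 3} (hw : MurasugiClass1 d w) :
    BTWellDefined w ∧ BT w = d := by
  obtain ⟨a, ⟨x, hx, -⟩, rfl⟩ := hw
  -- In `MurasugiClass1` the list itself is coerced to a list of integers through the list monad;
  -- this turns the coercion into a `map`.
  have ha : (do let x ← a; pure (x : ℤ)) = a.map fun x : ℕ => (x : ℤ) := by
    simp [← List.map_eq_flatMap]
  rw [garside_zpow_two_mul, ha, List.map_map]
  have key := bt_fullTwist_zpow_mul (v := (a.map fun x : ℕ => s₁ * s₂ ^ (-(x : ℤ))).prod) d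
    (t := 0) (C := 0) fun k => ⟨0, ?_, by simp⟩
  · simpa [Function.comp_def] using key
  have hmem := pow_mem (prod_mem_alternatingMonoid a) k
  refine isDehornoyFloor_zero ?_ (dehornoyPositive_inv_mul_fullTwist hmem)
  cases k with
  | zero => exact Or.inl (pow_zero _)
  | succ k =>
    right
    cases a with
    | nil => simp at hx
    | cons y a =>
      rw [pow_succ', List.map_cons, List.prod_cons]
      have := dehornoyPositive_mul_s₁_mul (one_mem _) (mul_mem (mul_mem (s₂_zpow_mem (-(y : ℤ)))
        (alternatingMonoid_le (prod_mem_alternatingMonoid a)))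
        (alternatingMonoid_le (pow_mem (prod_mem_alternatingMonoid (y :: a)) k)))
      simpa only [one_mul, mul_assoc, List.map_cons, List.prod_cons] using this

theorem s₂_zpow_floor (m : ℤ) :
    ∃ e : ℤ, IsDehornoyFloor (s₂ ^ m) e ∧ |(e : ℝ)| ≤ 1 := by
  rcases lt_or_ge m 0 with h | h
  · refine ⟨-1, isDehornoyFloor_neg_one (dehornoyPositive_fullTwist_mul (s₂_zpow_mem m)) ?_,
      by simp⟩
    have := dehornoyPositive_s₂_pow m.natAbs (by omega)
    rwa [← zpow_natCast, Int.natCast_natAbs, abs_of_neg h, zpow_neg] at this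
  · refine ⟨0, isDehornoyFloor_zero ?_ ?_, by simp⟩
    · obtain ⟨k, rfl⟩ := Int.eq_ofNat_of_zero_le h
      rw [zpow_natCast]
      rcases eq_or_ne k 0 with rfl | hk
      · exact Or.inl (pow_zero _)
      · exact Or.inr (dehornoyPositive_s₂_pow k hk)
    · rw [← (fullTwist_commute _).eq, ← zpow_neg]
      exact dehornoyPositive_fullTwist_mul (s₂_zpow_mem _)

theorem bt_class2 {d : ℤ} {w : BraidGroup 3} (hw : MurasugiClass2 d w) :
    BTWellDefined w ∧ BT w = d := by
  obtain ⟨m, rfl⟩ := hw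
  rw [garside_zpow_two_mul]
  have key := bt_fullTwist_zpow_mul (v := s₂ ^ m) d (t := 0) (C := 1) fun k => ?_
  · simpa using key
  rw [← zpow_natCast, ← zpow_mul]
  simpa using s₂_zpow_floor (m * k)

/-! ### Roots of the full twist and class (3) -/

theorem s₂_mul_s₁_pow_three : (s₂ * s₁) ^ 3 = fullTwist := by
  rw [fullTwist, garside_three]
  -- Δ² is read as (σ₂σ₁σ₂)(σ₁σ₂σ₁).
  nth_rw 1 [braid_relation]
  simp only [pow_succ, pow_zero, one_mul, mul_assoc]

theorem s₂_mul_s₁_sq_sq : (s₂ * s₁ ^ 2) ^ 2 = fullTwist := by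
  rw [← s₂_mul_s₁_pow_three, pow_three, pow_two, pow_two]
  calc s₂ * (s₁ * s₁) * (s₂ * (s₁ * s₁)) = s₂ * s₁ * (s₁ * s₂ * s₁) * s₁ := by group
    _ = s₂ * s₁ * (s₂ * s₁ * (s₂ * s₁)) := by rw [braid_relation]; group

theorem s₁_inv_mul_s₂_mul_s₁ : s₁⁻¹ * s₂ * s₁ = s₂ * s₁ * s₂⁻¹ := by
  rw [eq_mul_inv_iff_mul_eq, mul_assoc, mul_assoc, inv_mul_eq_iff_eq_mul, ← mul_assoc, ← mul_assoc,
    ← braid_relation]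

theorem s₂_mul_s₁_pow_three_eq_conj :
    s₂ * s₁ ^ 3 = s₁⁻¹ * (s₂ * s₁) ^ 2 * s₁ := by
  rw [eq_comm, mul_assoc, inv_mul_eq_iff_eq_mul, pow_two, pow_three]
  calc s₂ * s₁ * (s₂ * s₁) * s₁ = s₂ * s₁ * s₂ * s₁ * s₁ := by group
    _ = s₁ * (s₂ * (s₁ * (s₁ * s₁))) := by rw [← braid_relation]; group

theorem s₁_conj_pow_three : (s₁⁻¹ * (s₂ * s₁) * s₁) ^ 3 = fullTwist := by
  rw [show (s₁⁻¹ * (s₂ * s₁) * s₁) ^ 3 = s₁⁻¹ * (s₂ * s₁) ^ 3 * s₁ by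
    simp only [pow_succ, pow_zero, one_mul]; group]
  rw [s₂_mul_s₁_pow_three, mul_assoc, (fullTwist_commute s₁).eq, inv_mul_cancel_left]

/-- Positivity is not inherited from σ₂σ₁ by conjugation; here the word is rewritten as σ₂σ₁σ₂⁻¹σ₁,
which has no σ₁⁻¹. -/
theorem dehornoyPositive_s₁_conj : DehornoyPositive (s₁⁻¹ * (s₂ * s₁) * s₁) := by
  rw [← mul_assoc, s₁_inv_mul_s₂_mul_s₁, mul_assoc]
  exact dehornoyPositive_mul_s₁_mul s₂_mem (mul_mem s₂_inv_mem s₁_mem)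

/-- The negative powers of a positive braid `x` with `x ^ n = Δ²`, before `Δ⁻²`. -/
theorem isDehornoyFloor_inv_pow {x : BraidGroup 3} (hx : DehornoyPositive x) {r s : ℕ}
    (hr : r ≠ 0) (hs : s ≠ 0) (h : x ^ (r + s) = fullTwist) :
    IsDehornoyFloor (x⁻¹ ^ r) (-1) := by
  have hpos (k : ℕ) (hk : k ≠ 0) : DehornoyPositive (x ^ k) := by
    induction k with
    | zero => exact absurd rfl hk
    | succ k ih =>
      rcases eq_or_ne k 0 with rfl | hk'
      · simpa using hx
      · rw [pow_succ]; exact (ih hk').mul hx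
  refine isDehornoyFloor_neg_one ?_ ?_
  · rw [← h, add_comm, pow_add, inv_pow, mul_inv_cancel_right]
    exact hpos s hs
  · rw [inv_pow, inv_inv]; exact hpos r hr

theorem dehornoyPositive_s₂_mul_s₁_mul {y : BraidGroup 3} (hy : y ∈ sigmaOneNonneg) :
    DehornoyPositive (s₂ * s₁ * y) :=
  dehornoyPositive_mul_s₁_mul s₂_mem hy

theorem s₁_zpow_neg_mul_s₂_inv (k : ℕ) :
    s₁ ^ (-(k : ℤ)) * s₂⁻¹ = (s₂ * s₁ ^ k)⁻¹ := by
  rw [mul_inv_rev, zpow_neg, zpow_natCast]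

theorem bt_class3_neg_one (d : ℤ) :
    BTWellDefined (fullTwist ^ d * (s₁ ^ (-1 : ℤ) * s₂⁻¹)) ∧
      BT (fullTwist ^ d * (s₁ ^ (-1 : ℤ) * s₂⁻¹)) = d - 1 / 3 := by
  have e : s₁ ^ (-1 : ℤ) * s₂⁻¹ = (s₂ * s₁)⁻¹ := by simp
  have hx : DehornoyPositive (s₂ * s₁) := by
    simpa using dehornoyPositive_s₂_mul_s₁_mul (one_mem _)
  have key := bt_of_periodic (v := (s₂ * s₁)⁻¹) d (p := 3) (c := -1) (by norm_num)
    (by rw [inv_pow, s₂_mul_s₁_pow_three, zpow_neg_one]) fun r hr => ?_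
  · rw [e]
    refine ⟨key.1, key.2.trans ?_⟩
    push_cast; ring
  · rcases eq_or_ne r 0 with rfl | hr0
    · exact ⟨0, by simpa using isDehornoyFloor_one⟩
    · refine ⟨-1, isDehornoyFloor_inv_pow hx hr0 (s := 3 - r) (by omega) ?_⟩
      rw [show r + (3 - r) = 3 by omega, s₂_mul_s₁_pow_three]

theorem bt_class3_neg_two (d : ℤ) :
    BTWellDefined (fullTwist ^ d * (s₁ ^ (-2 : ℤ) * s₂⁻¹)) ∧
      BT (fullTwist ^ d * (s₁ ^ (-2 : ℤ) * s₂⁻¹)) = d - 1 / 2 := by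
  have e : s₁ ^ (-2 : ℤ) * s₂⁻¹ = (s₂ * s₁ ^ 2)⁻¹ := s₁_zpow_neg_mul_s₂_inv 2
  have hx : DehornoyPositive (s₂ * s₁ ^ 2) := by
    simpa [pow_two, mul_assoc] using dehornoyPositive_s₂_mul_s₁_mul s₁_mem
  have key := bt_of_periodic (v := (s₂ * s₁ ^ 2)⁻¹) d (p := 2) (c := -1) (by norm_num)
    (by rw [inv_pow, s₂_mul_s₁_sq_sq, zpow_neg_one]) fun r hr => ?_
  · rw [e]
    refine ⟨key.1, key.2.trans ?_⟩
    push_cast; ring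
  · rcases eq_or_ne r 0 with rfl | hr0
    · exact ⟨0, by simpa using isDehornoyFloor_one⟩
    · refine ⟨-1, isDehornoyFloor_inv_pow hx hr0 (s := 2 - r) (by omega) ?_⟩
      rw [show r + (2 - r) = 2 by omega, s₂_mul_s₁_sq_sq]

theorem bt_class3_neg_three (d : ℤ) :
    BTWellDefined (fullTwist ^ d * (s₁ ^ (-3 : ℤ) * s₂⁻¹)) ∧
      BT (fullTwist ^ d * (s₁ ^ (-3 : ℤ) * s₂⁻¹)) = d - 2 / 3 := by
  -- σ₂σ₁³ is the square of this cube root of Δ², so v = x⁻² and v³ = Δ⁻⁴.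
  set x := s₁⁻¹ * (s₂ * s₁) * s₁ with hxdef
  have hsq : s₂ * s₁ ^ 3 = x ^ 2 := by
    rw [s₂_mul_s₁_pow_three_eq_conj, hxdef]; simp only [pow_two]; group
  have e : s₁ ^ (-3 : ℤ) * s₂⁻¹ = x⁻¹ ^ 2 := by
    rw [inv_pow, ← hsq]; exact s₁_zpow_neg_mul_s₂_inv 3
  have hx : DehornoyPositive x := dehornoyPositive_s₁_conj
  have h3 : x ^ 3 = fullTwist := s₁_conj_pow_three
  have key := bt_of_periodic (v := x⁻¹ ^ 2) d (p := 3) (c := -2) (by norm_num)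
    (by rw [pow_right_comm, inv_pow, h3, zpow_neg, inv_pow]; rfl) fun r hr => ?_
  · rw [e]
    refine ⟨key.1, key.2.trans ?_⟩
    push_cast; ring
  · interval_cases r
    · exact ⟨0, by simpa using isDehornoyFloor_one⟩
    · exact ⟨-1, by simpa using isDehornoyFloor_inv_pow hx two_ne_zero one_ne_zero h3⟩
    -- Here v² = x⁻⁴ = Δ⁻²x⁻¹, one full twist below x⁻¹, whose floor is -1.
    · refine ⟨-1 + -1, ?_⟩
      have := (isDehornoyFloor_inv_pow hx one_ne_zero two_ne_zero h3).fullTwist_zpow_mul (-1)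
      rw [zpow_neg_one, ← h3, ← inv_pow, ← pow_add] at this
      rwa [← pow_mul]

end Braid

theorem proposition6p6 (d : ℤ) (w : Braid.BraidGroup 3) :
    (Braid.MurasugiClass1 d w → Braid.BTWellDefined w ∧ Braid.BT w = (d : ℝ)) ∧
    (Braid.MurasugiClass2 d w → Braid.BTWellDefined w ∧ Braid.BT w = (d : ℝ)) ∧
    (∀ m : ℤ, Braid.MurasugiClass3 d m w → Braid.BTWellDefined w ∧
      (m = -1 → Braid.BT w = (d : ℝ) - 1 / 3) ∧
      (m = -2 → Braid.BT w = (d : ℝ) - 1 / 2) ∧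
      (m = -3 → Braid.BT w = (d : ℝ) - 2 / 3)) := by
  refine ⟨Braid.bt_class1, Braid.bt_class2, ?_⟩
  rintro m ⟨rfl | rfl | rfl, rfl⟩
  all_goals rw [Braid.garside_zpow_two_mul]
  · exact ⟨(Braid.bt_class3_neg_one d).1, fun _ => (Braid.bt_class3_neg_one d).2,
      fun h => absurd h (by norm_num), fun h => absurd h (by norm_num)⟩
  · exact ⟨(Braid.bt_class3_neg_two d).1, fun h => absurd h (by norm_num),
      fun _ => (Braid.bt_class3_neg_two d).2, fun h => absurd h (by norm_num)⟩
  · exact ⟨(Braid.bt_class3_neg_three d).1, fun h => absurd h (by norm_num),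
      fun h => absurd h (by norm_num), fun _ => (Braid.bt_class3_neg_three d).2⟩
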